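/- Let $R$ be an associative ring with identity and let $M$ be a unitary right $R$-module. Call $M$ \emph{endoregular} if $\operatorname{End}_R(M)$ is von Neumann regular, and \emph{abelian endoregular} if moreover every idempotent of $\operatorname{End}_R(M)$ is central. Call $M$ \emph{quasi-duo} if every maximal submodule $N$ of $M$ is fully invariant, i.e. $\varphi(N)\subseteq N$ for all $\varphi\in\operatorname{End}_R(M)$. Call $M$ a \emph{subdirect product of simple modules} if there are a family $(S_j)_{j\in J}$ of simple $R$-modules and a monomorphism $\alpha\colon M\to\prod_{j\in J}S_j$ such that $\pi_j\alpha\colon M\to S_j$ is surjective for every $j\in J$, where $\pi_j$ is the canonical projection. Let $\operatorname{Rad}(M)$ be the intersection of all maximal submodules of $M$ (with $\operatorname{Rad}(M)=M$ if there are none). For an $R$-module $X$, call $M$ \emph{$X$-projective} if for every epimorphism $\pi\colon X\to N$ and every homomorphism $f\colon M\to N$ there is a homomorphism $g\colon M\to X$ with $\pi g=f$; and let $M^{(I)}$ denote the direct sum of copies of $M$ indexed by the set $I$. Theorem. Consider the following conditions: (1) $M$ is a quasi-duo endoregular module and $M$ is a subdirect product of simple modules; (2) $M$ is an abelian endoregular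 module and $\operatorname{Rad}(M)=0$. Then (1) implies (2). If $M$ is $M^{(I)}$-projective for every index set $I$, then (1) and (2) are equivalent. -/

import Mathlib

universe u v w w₁ w₂

namespace AbelianEndoregular

/-- A ring is von Neumann regular if every `r` has some `x` with `r x r = r`. -/
def IsVonNeumannRegular (S : Type u) [Ring S] : Prop :=
  ∀ r : S, ∃ x : S, r * x * r = r

/-- A ring is abelian if every idempotent is central. -/
def IsAbelianRing (S : Type u) [Ring S] : Prop :=
  ∀ e : S, IsIdempotentElem e → ∀ x : S, e * x = x * e

section Modules

variable (R : Type u) [Ring R] (M : Type v) [AddCommGroup M] [Module R M]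

/-- A module is endoregular if its endomorphism ring is von Neumann regular. -/
def IsEndoregular : Prop :=
  IsVonNeumannRegular (Module.End R M)

/-- A module is abelian endoregular if its endomorphism ring is an abelian von Neumann
regular ring. -/
def IsAbelianEndoregular : Prop :=
  IsAbelianRing (Module.End R M) ∧ IsVonNeumannRegular (Module.End R M)

/-- A module is quasi-duo if every maximal submodule is fully invariant. -/
def IsQuasiDuo : Prop :=
  ∀ N : Submodule R M, IsCoatom N → N.IsFullyInvariant

/-- `M` is (isomorphic to) a subdirect product of the family `S`: it embeds in the product
so that all the canonical projections restricted to `M` are surjective. -/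
def IsSubdirectProduct {J : Type w₁} (S : J → Type w₂) [∀ j, AddCommGroup (S j)]
    [∀ j, Module R (S j)] : Prop :=
  ∃ α : M →ₗ[R] (∀ j, S j), Function.Injective α ∧
    ∀ j, Function.Surjective ((LinearMap.proj j : (∀ j, S j) →ₗ[R] S j) ∘ₗ α)

/-- `M` is a subdirect product of some (possibly empty) family of simple modules. -/
def IsSubdirectProductOfSimples : Prop :=
  ∃ (J : Type w₁) (S : J → Type w₂) (_ : ∀ j, AddCommGroup (S j)) (_ : ∀ j, Module R (S j)),
    (∀ j, IsSimpleModule R (S j)) ∧ IsSubdirectProduct R M S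

/-- `M` is `X`-projective: every homomorphism from `M` to a module `N` lifts along every
epimorphism `X → N`. (Up to isomorphism every epimorphic image `N` of `X` lies in the
universe of `X`.) -/
def IsRelativelyProjective (X : Type w) [AddCommGroup X] [Module R X] : Prop :=
  ∀ (N : Type w) [AddCommGroup N] [Module R N] (π : X →ₗ[R] N) (f : M →ₗ[R] N),
    Function.Surjective π → ∃ g : M →ₗ[R] X, π ∘ₗ g = f

end Modules

end AbelianEndoregular

/-!
Write `S` for the endomorphism ring of `M` and `Rad M` for `Module.jacobson R M`.

For the forward direction, a module that embeds in a product of simple modules has zero radical.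
If `M` is quasi-duo with `Rad M = 0` and `φ ∈ S` has square zero, then `φ M ≤ N` for every maximal
submodule `N`: otherwise `M = N + φ M`, and applying `φ` gives `φ M = φ N ≤ N`. Hence `S` is reduced,
and so idempotents of `S` are central.

For the converse, the radical being zero says that `M` embeds in the product of its simple quotients.
The point is that `M` is quasi-duo, for which self-projectivity suffices
(`isQuasiDuo_of_isAbelianEndoregular`). If `N` is maximal and `φ N ≰ N`, then `φ` induces an
epimorphism `N → M ⧸ N`, and the projection `π : M → M ⧸ N` lifts along it to `g : M → N`, so that
`π φ g = π`. In an abelian regular ring right ideals are two-sided, so `φ g ∈ g S` also takes its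
values in `N`. Then `π = 0`, which is absurd.
-/

namespace AbelianEndoregular

theorem isAbelianRing_of_isReduced (S : Type*) [Ring S] [IsReduced S] : IsAbelianRing S := by
  intro e he x
  have he : e * e = e := he
  -- Both `e x (1 - e)` and `(1 - e) x e` have square zero.
  have hl : e * x * (1 - e) = 0 := by
    refine IsReduced.eq_zero _ ⟨2, ?_⟩
    calc (e * x * (1 - e)) ^ 2 = e * x * (e - e * e) * x * (1 - e) := by noncomm_ring
      _ = 0 := by simp [he]
  have hr : (1 - e) * x * e = 0 := by
    refine IsReduced.eq_zero _ ⟨2, ?_⟩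
    calc ((1 - e) * x * e) ^ 2 = (1 - e) * x * (e - e * e) * x * e := by noncomm_ring
      _ = 0 := by simp [he]
  calc e * x = e * x * (1 - e) + e * x * e := by noncomm_ring
    _ = (1 - e) * x * e + e * x * e := by rw [hl, hr]
    _ = x * e := by noncomm_ring

/-- In an abelian regular ring every right ideal is two-sided. -/
theorem exists_mul_eq_mul {S : Type*} [Ring S] (hab : IsAbelianRing S)
    (hreg : IsVonNeumannRegular S) (s g : S) : ∃ t, s * g = g * t := by
  obtain ⟨x, hx⟩ := hreg g
  have hgx : IsIdempotentElem (g * x) := by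
    unfold IsIdempotentElem
    rw [← mul_assoc, hx]
  refine ⟨x * s * g, ?_⟩
  calc s * g = s * (g * x) * g := by rw [mul_assoc, hx]
    _ = g * x * s * g := by rw [hab _ hgx s]
    _ = g * (x * s * g) := by noncomm_ring

variable {R : Type u} [Ring R] {M : Type v} [AddCommGroup M] [Module R M]

theorem jacobson_eq_bot_of_isSubdirectProductOfSimples
    (h : IsSubdirectProductOfSimples.{u, v, w₁, w₂} R M) : Module.jacobson R M = ⊥ := by
  obtain ⟨J, S, _, _, hS, α, hα, -⟩ := h
  refine Module.jacobson_eq_bot_of_injective α hα (Module.jacobson_pi_eq_bot _ _ fun j ↦ ?_)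
  have := hS j
  exact IsSimpleModule.jacobson_eq_bot R _

theorem isSubdirectProductOfSimples_of_jacobson_eq_bot (h : Module.jacobson R M = ⊥) :
    IsSubdirectProductOfSimples.{u, v, v, v} R M := by
  refine ⟨{N : Submodule R M // IsCoatom N}, fun N ↦ M ⧸ N.1, inferInstance, inferInstance,
    fun N ↦ isSimpleModule_iff_isCoatom.2 N.2, LinearMap.pi fun N ↦ N.1.mkQ, ?_,
    fun N ↦ N.1.mkQ_surjective⟩
  rw [← LinearMap.ker_eq_bot, eq_bot_iff, ← h]
  intro m hm
  refine Submodule.mem_sInf.2 fun N hN ↦ ?_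
  exact (Submodule.Quotient.mk_eq_zero N).1 (congrFun hm ⟨N, hN⟩)

theorem isReduced_end_of_isQuasiDuo (hq : IsQuasiDuo R M) (hj : Module.jacobson R M = ⊥) :
    IsReduced (Module.End R M) := by
  refine (isReduced_iff_pow_one_lt 2 one_lt_two).2 fun φ hφ ↦ ?_
  ext m
  have hm : φ m ∈ Module.jacobson R M := by
    refine Submodule.mem_sInf.2 fun N hN ↦ ?_
    by_contra hmN
    -- Otherwise `M = N + φ M`, and `φ² = 0` places `φ M = φ N` inside `N`.
    have htop : N ⊔ LinearMap.range φ = ⊤ := by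
      refine hN.2 _ (lt_of_le_of_ne le_sup_left fun h ↦ hmN ?_)
      rw [h]
      exact Submodule.mem_sup_right ⟨m, rfl⟩
    obtain ⟨n, hn, _, ⟨y, rfl⟩, rfl⟩ := Submodule.mem_sup.1 (htop ▸ Submodule.mem_top (x := m))
    refine hmN ?_
    have hy : φ (φ y) = 0 := by
      simpa [sq] using LinearMap.congr_fun hφ y
    rw [map_add, hy, add_zero]
    exact hq N hN φ hn
  simpa [hj] using hm

theorem isAbelianEndoregular_of_isQuasiDuo (hq : IsQuasiDuo R M) (hr : IsEndoregular R M)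
    (hj : Module.jacobson R M = ⊥) : IsAbelianEndoregular R M :=
  have := isReduced_end_of_isQuasiDuo hq hj
  ⟨isAbelianRing_of_isReduced _, hr⟩

/-- Relative projectivity over `M` passes to submodules `N` of `M`: a quotient of `N`
embeds in the quotient of `M` by the same kernel, and a lift to `M` then lands in `N`. -/
theorem IsRelativelyProjective.exists_lift_submodule {P Q : Type*} [AddCommGroup P] [Module R P]
    [AddCommGroup Q] [Module R Q] (hP : IsRelativelyProjective R P M) (N : Submodule R M)
    (p : N →ₗ[R] Q) (hp : Function.Surjective p) (f : P →ₗ[R] Q) :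
    ∃ g : P →ₗ[R] N, p ∘ₗ g = f := by
  let K : Submodule R M := (LinearMap.ker p).map N.subtype
  let ι : (N ⧸ LinearMap.ker p) →ₗ[R] M ⧸ K :=
    (LinearMap.ker p).mapQ K N.subtype (Submodule.le_comap_map _ _)
  let E := p.quotKerEquivOfSurjective hp
  obtain ⟨h, hh⟩ := hP (M ⧸ K) K.mkQ (ι ∘ₗ E.symm.toLinearMap ∘ₗ f) K.mkQ_surjective
  -- Since `K ≤ N` is the kernel of `p`, the value `h m` lies in `N` and is sent to `f m` by `p`.
  have key (m : P) : ∃ n : N, h m = n ∧ p n = f m := by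
    obtain ⟨n, hn⟩ := hp (f m)
    have hE : E.symm (f m) = Submodule.Quotient.mk n := by
      rw [LinearEquiv.symm_apply_eq, ← hn]
      rfl
    have h₁ : (Submodule.Quotient.mk (h m) : M ⧸ K) = Submodule.Quotient.mk (n : M) := by
      have := LinearMap.congr_fun hh m
      simp only [LinearMap.comp_apply, LinearEquiv.coe_coe, hE] at this
      exact this
    obtain ⟨k, hk, hkm⟩ := (Submodule.Quotient.eq K).1 h₁
    refine ⟨n + k, ?_, ?_⟩
    · have hkm : (k : M) = h m - n := hkm
      rw [Submodule.coe_add, hkm]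
      abel
    · rw [map_add, LinearMap.mem_ker.1 hk, add_zero, hn]
  refine ⟨h.codRestrict N fun m ↦ ?_, ?_⟩
  · obtain ⟨n, hn, -⟩ := key m
    exact hn ▸ n.2
  · ext m
    obtain ⟨n, hn, hpn⟩ := key m
    rw [← hpn]
    exact congrArg p (Subtype.ext hn)

theorem isQuasiDuo_of_isAbelianEndoregular (hab : IsAbelianEndoregular R M)
    (hP : IsRelativelyProjective R M M) : IsQuasiDuo R M := by
  intro N hN φ
  by_contra hφ
  have := isSimpleModule_iff_isCoatom.2 hN
  have hne : N.mkQ ∘ₗ φ ∘ₗ N.subtype ≠ 0 := by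
    intro h
    refine hφ fun n hn ↦ ?_
    exact (Submodule.Quotient.mk_eq_zero N).1 (LinearMap.congr_fun h ⟨n, hn⟩)
  obtain ⟨g, hg⟩ := hP.exists_lift_submodule N _ (LinearMap.surjective_of_ne_zero hne) N.mkQ
  obtain ⟨t, ht⟩ := exists_mul_eq_mul hab.1 hab.2 φ (N.subtype ∘ₗ g)
  refine hN.1 (eq_top_iff.2 fun m _ ↦ ?_)
  rw [← Submodule.Quotient.mk_eq_zero N]
  have hφg : φ (g m) = g (t m) := LinearMap.congr_fun ht m
  calc (Submodule.Quotient.mk m : M ⧸ N) = Submodule.Quotient.mk (φ (g m)) :=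
        (LinearMap.congr_fun hg m).symm
    _ = 0 := by
        rw [hφg]
        exact (Submodule.Quotient.mk_eq_zero N).2 (g (t m)).2

/-- Relative projectivity transfers along a linear equivalence. As `X` may live in a larger
universe than `M`, the quotient of `M` is lifted to the universe of `X`. -/
theorem IsRelativelyProjective.of_equiv {P : Type*} [AddCommGroup P] [Module R P]
    {X : Type (max w v)} [AddCommGroup X] [Module R X] (e : X ≃ₗ[R] M)
    (hP : IsRelativelyProjective R P X) : IsRelativelyProjective R P M := by
  intro N _ _ π f hπ
  let E : ULift.{w} N ≃ₗ[R] N := ULift.moduleEquiv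
  obtain ⟨g, hg⟩ := hP (ULift.{w} N) (E.symm.toLinearMap ∘ₗ π ∘ₗ e.toLinearMap)
    (E.symm.toLinearMap ∘ₗ f) (E.symm.surjective.comp (hπ.comp e.surjective))
  refine ⟨e.toLinearMap ∘ₗ g, ?_⟩
  ext m
  exact E.symm.injective (LinearMap.congr_fun hg m)

end AbelianEndoregular

theorem mainTheorem5 {R : Type u} [Ring R] {M : Type v} [AddCommGroup M]
    [Module R M] :
    ((AbelianEndoregular.IsQuasiDuo R M ∧ AbelianEndoregular.IsEndoregular R M ∧
        AbelianEndoregular.IsSubdirectProductOfSimples.{u, v, w₁, w₂} R M) →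
      (AbelianEndoregular.IsAbelianEndoregular R M ∧ Module.jacobson R M = ⊥)) ∧
    ((∀ I : Type w, AbelianEndoregular.IsRelativelyProjective R M (I →₀ M)) →
      ((AbelianEndoregular.IsQuasiDuo R M ∧ AbelianEndoregular.IsEndoregular R M ∧
          AbelianEndoregular.IsSubdirectProductOfSimples.{u, v, v, v} R M) ↔
        (AbelianEndoregular.IsAbelianEndoregular R M ∧ Module.jacobson R M = ⊥))) := by
  open AbelianEndoregular in
  refine ⟨fun ⟨hq, hr, hs⟩ ↦ ?_, fun hP ↦ ⟨fun ⟨hq, hr, hs⟩ ↦ ?_, fun ⟨hab, hj⟩ ↦ ?_⟩⟩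
  · have hj := jacobson_eq_bot_of_isSubdirectProductOfSimples hs
    exact ⟨isAbelianEndoregular_of_isQuasiDuo hq hr hj, hj⟩
  · have hj := jacobson_eq_bot_of_isSubdirectProductOfSimples hs
    exact ⟨isAbelianEndoregular_of_isQuasiDuo hq hr hj, hj⟩
  · -- A one-element index set gives self-projectivity.
    have hM : IsRelativelyProjective R M M :=
      (hP PUnit).of_equiv (Finsupp.uniqueLinearEquiv R M PUnit.unit)
    exact ⟨isQuasiDuo_of_isAbelianEndoregular hab hM, hab.2,
      isSubdirectProductOfSimples_of_jacobson_eq_bot hj⟩
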